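/- Let $\lambda\in(0,1)$. For $n\ge 1$ let $W_n=(\lambda^n,\lambda^{n-1}]$; these intervals partition $(0,1]$. Let $F_\lambda:(0,1]\to(0,1]$ be the map with $F_\lambda(x)=\frac{x-\lambda}{1-\lambda}$ for $x\in W_1$ and $F_\lambda(x)=\frac{x-\lambda^n}{\lambda(1-\lambda)}$ for $x\in W_n$, $n\ge 2$. For $K\in\mathbb N$ let $$\Lambda_K=\Bigl\{x\in(0,1] : F_\lambda^i(x)\notin \bigcup_{k>K}W_k \text{ for all } i\ge 0\Bigr\}.$$ Then the limit $\lim_{K\to\infty}\dim_H(\Lambda_K)$ of Hausdorff dimensions exists, and $$\lim_{K\to\infty}\dim_H(\Lambda_K)=\begin{cases}1 & \text{if }\lambda\le\frac12,\\[1mm] -\dfrac{\log 4}{\log[\lambda(1-\lambda)]} & \text{if }\lambda\ge\frac12.\end{cases}$$ -/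

import Mathlib

open Set Filter Topology

/-- The intervals `W_n = (lam ^ n, lam ^ (n - 1)]`, used for `n ≥ 1`
(for `n = 0` the truncated subtraction makes this the empty interval `(1, 1]`). -/
def W (lam : ℝ) (n : ℕ) : Set ℝ := Ioc (lam ^ n) (lam ^ (n - 1))

open Classical in
/-- The piecewise linear map `F_lam : (0, 1] → (0, 1]`:
`F x = (x - lam) / (1 - lam)` on `W_1`, and
`F x = (x - lam ^ n) / (lam * (1 - lam))` on `W_n` for `n ≥ 2`.
As a function on `ℝ` it is given the value `0` outside `(0, 1]`; no orbit
starting in `(0, 1]` leaves `(0, 1]` (see `F_mapsTo`). -/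
noncomputable def F (lam : ℝ) (x : ℝ) : ℝ :=
  if x ∈ W lam 1 then (x - lam) / (1 - lam)
  else if h : ∃ n : ℕ, 2 ≤ n ∧ x ∈ W lam n then
    (x - lam ^ Nat.find h) / (lam * (1 - lam))
  else 0

/-- The points of `(0, 1]` whose whole forward orbit avoids every `W_k` with `k > K`. -/
def Lambda (lam : ℝ) (K : ℕ) : Set ℝ :=
  {x | x ∈ Ioc (0 : ℝ) 1 ∧ ∀ i : ℕ, (F lam)^[i] x ∉ ⋃ k : ℕ, ⋃ _ : K < k, W lam k}

/-- The intervals `W_n` are pairwise disjoint. -/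
theorem W_index_unique {lam : ℝ} (h0 : 0 < lam) (h1 : lam < 1) {x : ℝ} {m n : ℕ}
    (hm : x ∈ W lam m) (hn : x ∈ W lam n) : m = n := by
  have key : ∀ {a b : ℕ}, x ∈ W lam a → x ∈ W lam b → ¬ a < b := by
    intro a b ha hb hab
    have h2 : lam ^ (b - 1) ≤ lam ^ a :=
      pow_le_pow_of_le_one h0.le h1.le (by omega)
    exact absurd (ha.1.trans_le (hb.2.trans h2)) (lt_irrefl _)
  have h3 := key hm hn
  have h4 := key hn hm
  omega

/-- The intervals `W_n`, `n ≥ 1`, cover `(0, 1]`. -/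
theorem exists_mem_W {lam : ℝ} (h1 : lam < 1) {x : ℝ}
    (hx : x ∈ Ioc (0 : ℝ) 1) : ∃ n : ℕ, 1 ≤ n ∧ x ∈ W lam n := by
  classical
  have hex : ∃ n : ℕ, lam ^ n < x := exists_pow_lt_of_lt_one hx.1 h1
  have hpos : 1 ≤ Nat.find hex := by
    rw [Nat.one_le_iff_ne_zero]
    intro h
    have := Nat.find_spec hex
    rw [h, pow_zero] at this
    exact absurd (this.trans_le hx.2) (lt_irrefl _)
  exact ⟨Nat.find hex, hpos, Nat.find_spec hex,
    not_lt.1 (Nat.find_min hex (by omega))⟩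

theorem F_of_mem_W_one {lam : ℝ} {x : ℝ} (hx : x ∈ W lam 1) :
    F lam x = (x - lam) / (1 - lam) := by
  simp [F, hx]

theorem F_of_mem_W {lam : ℝ} (h0 : 0 < lam) (h1 : lam < 1) {x : ℝ} {n : ℕ} (hn : 2 ≤ n)
    (hx : x ∈ W lam n) : F lam x = (x - lam ^ n) / (lam * (1 - lam)) := by
  classical
  have h : ∃ m : ℕ, 2 ≤ m ∧ x ∈ W lam m := ⟨n, hn, hx⟩
  have hne : x ∉ W lam 1 := fun h' => by
    have := W_index_unique h0 h1 h' hx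
    omega
  have hfind : Nat.find h = n := W_index_unique h0 h1 (Nat.find_spec h).2 hx
  rw [F, if_neg hne, dif_pos h, hfind]

theorem F_mapsTo {lam : ℝ} (h0 : 0 < lam) (h1 : lam < 1) :
    MapsTo (F lam) (Ioc 0 1) (Ioc 0 1) := by
  intro x hx
  have h1' : 0 < 1 - lam := sub_pos.2 h1
  obtain ⟨n, hn, hxn⟩ := exists_mem_W h1 hx
  rcases Nat.lt_or_ge n 2 with h | h
  · obtain rfl : n = 1 := by omega
    rw [F_of_mem_W_one hxn]
    have hl : lam < x := by simpa using hxn.1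
    refine ⟨div_pos (sub_pos.2 hl) h1', ?_⟩
    rw [div_le_one h1']
    linarith [hx.2]
  · rw [F_of_mem_W h0 h1 h hxn]
    refine ⟨div_pos (sub_pos.2 hxn.1) (mul_pos h0 h1'), ?_⟩
    rw [div_le_one (mul_pos h0 h1')]
    obtain ⟨m, rfl⟩ : ∃ m, n = m + 2 := ⟨n - 2, by omega⟩
    have hu : x ≤ lam ^ (m + 1) := hxn.2
    have hm : lam ^ m ≤ 1 := pow_le_one₀ h0.le h1.le
    have e1 : lam ^ (m + 1) = lam ^ m * lam := pow_succ _ _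
    have e2 : lam ^ (m + 2) = lam ^ m * lam * lam := by rw [pow_succ, pow_succ]
    have hp : 0 ≤ (1 - lam ^ m) * (lam * (1 - lam)) :=
      mul_nonneg (sub_nonneg.2 hm) (mul_pos h0 h1').le
    nlinarith

/-!
The map `F lam` is a Markov map: with the cells `W lam (m + 1)` numbered by `m ≥ 0`, it sends the
cell `m` affinely onto `(0, lam ^ (m - 1)]`, with inverse branch of ratio `ratio lam m`, namely
`1 - lam` for `m = 0` and `lam * (1 - lam)` otherwise. If `τ m` denotes the `s`-dimensional mass of
the part of `Lambda lam K` in `(0, lam ^ m]`, self-similarity reads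
`τ m = τ (m + 1) + ratio lam m ^ s * τ (m - 1)`, with `τ m = 0` for `m ≥ K`. Away from `m = 0` this
is a linear recurrence with characteristic polynomial `q ^ 2 - q + b`, `b = (lam * (1 - lam)) ^ s`,
and the two regimes correspond to its discriminant and to the boundary condition at `m = 0`.

*Upper bound* (`dimH_Lambda_le_of_supersolution`). A positive decreasing supersolution on all of `ℕ`
bounds the Hausdorff premeasure of every scale, by induction on the scale. For `1 / 2 ≤ lam` the
sequence `(1 / 2) ^ m` is one at the exponent for which `b = 1 / 4`; for `lam ≤ 1 / 2` the bound `1`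
is trivial.

*Lower bound* (`MassData.le_dimH`). Below the claimed limit, `q * (1 - q) < b` for every `q` up to
the initial ratio `τ 1 / τ 0 = 1 - (1 - lam) ^ s`, so the solution of the recurrence with `τ 0 = 1`
becomes nonpositive somewhere (`exists_recSol_nonpos`). Cutting it off there, at `K`, distributes
unit mass on the first `K` cells, each branch scaling mass by at most the `s`-th power of its ratio
(`exists_massData`). The distribution function `G` of this mass, obtained as the bounded solution of
a functional equation, is `s`-Hölder (`IsDistribution.exists_holderOnWith`), maps `(0, 1]` onto a
set containing `[0, 1]`, and takes only countably many values off `Lambda lam K`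
(`IsDistribution.countable_image_compl`). Hence `G '' Lambda lam K` has dimension `1`, and
`Lambda lam K` has dimension at least `s`.
-/

open MeasureTheory MeasureTheory.Measure ENNReal NNReal

/-! ### Cells and branches -/

/-- The contraction ratio of the inverse branch of `F lam` on the cell `W lam (m + 1)`. Cells are
numbered from `0` here, so that with truncated subtraction `F lam` maps the cell `m` onto
`(0, lam ^ (m - 1)]` for every `m`. -/
noncomputable def ratio (lam : ℝ) (m : ℕ) : ℝ := if m = 0 then 1 - lam else lam * (1 - lam)

section Cells

variable {lam : ℝ}

lemma ratio_pos (h0 : 0 < lam) (h1 : lam < 1) (m : ℕ) : 0 < ratio lam m := by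
  have : 0 < 1 - lam := sub_pos.2 h1
  unfold ratio; split_ifs <;> positivity

lemma ratio_le (lam : ℝ) (m : ℕ) : ratio lam m ≤ 1 - lam := by
  unfold ratio
  split_ifs
  · exact le_rfl
  · nlinarith [sq_nonneg (1 - lam)]

lemma F_of_mem_cell (h0 : 0 < lam) (h1 : lam < 1) {m : ℕ} {x : ℝ} (hx : x ∈ W lam (m + 1)) :
    F lam x = (x - lam ^ (m + 1)) / ratio lam m := by
  rcases m with _ | m
  · rw [F_of_mem_W_one hx]; simp [ratio]
  · rw [F_of_mem_W h0 h1 (by omega) hx]; simp [ratio]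

lemma eq_branch_F (h0 : 0 < lam) (h1 : lam < 1) {m : ℕ} {x : ℝ} (hx : x ∈ W lam (m + 1)) :
    x = lam ^ (m + 1) + ratio lam m * F lam x := by
  have := (ratio_pos h0 h1 m).ne'
  rw [F_of_mem_cell h0 h1 hx]; field_simp; ring

lemma pow_mem_cell (h0 : 0 < lam) (h1 : lam < 1) (m : ℕ) : lam ^ m ∈ W lam (m + 1) :=
  ⟨pow_lt_pow_right_of_lt_one₀ h0 h1 (Nat.lt_succ_self m), le_rfl⟩

lemma F_pow (h0 : 0 < lam) (h1 : lam < 1) (m : ℕ) : F lam (lam ^ m) = lam ^ (m - 1) := by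
  have h1' : (1 : ℝ) - lam ≠ 0 := (sub_pos.2 h1).ne'
  rw [F_of_mem_cell h0 h1 (pow_mem_cell h0 h1 m)]
  rcases m with _ | m
  · simp [ratio, h1']
  · simp only [ratio, Nat.add_sub_cancel, Nat.add_eq_zero_iff, one_ne_zero, and_false, if_false]
    field_simp
    ring

lemma F_le_pow (h0 : 0 < lam) (h1 : lam < 1) {m : ℕ} {x : ℝ} (hx : x ∈ W lam (m + 1)) :
    F lam x ≤ lam ^ (m - 1) := by
  have := ratio_pos h0 h1 m
  rw [← F_pow h0 h1, F_of_mem_cell h0 h1 hx, F_of_mem_cell h0 h1 (pow_mem_cell h0 h1 m)]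
  have h2 : x ≤ lam ^ m := hx.2
  gcongr

lemma sub_eq_ratio_mul (h0 : 0 < lam) (h1 : lam < 1) {m : ℕ} {x y : ℝ}
    (hx : x ∈ W lam (m + 1)) (hy : y ∈ W lam (m + 1)) :
    y - x = ratio lam m * (F lam y - F lam x) := by
  nth_rewrite 1 [eq_branch_F h0 h1 hx]
  nth_rewrite 1 [eq_branch_F h0 h1 hy]
  ring

lemma exists_mem_cell (h1 : lam < 1) {x : ℝ} (hx : x ∈ Ioc (0 : ℝ) 1) :
    ∃ m : ℕ, x ∈ W lam (m + 1) := by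
  obtain ⟨n, hn, h⟩ := exists_mem_W h1 hx
  exact ⟨n - 1, by rwa [Nat.sub_add_cancel hn]⟩

lemma mem_Ioc_of_mem_cell (h0 : 0 < lam) (h1 : lam < 1) {m : ℕ} {x : ℝ}
    (hx : x ∈ W lam (m + 1)) : x ∈ Ioc (0 : ℝ) 1 :=
  ⟨(by positivity : (0 : ℝ) < lam ^ (m + 1)).trans hx.1,
    hx.2.trans (pow_le_one₀ h0.le h1.le)⟩

lemma le_cell_of_le (h0 : 0 < lam) (h1 : lam < 1) {m k : ℕ} {x : ℝ}
    (hx : x ∈ W lam (m + 1)) (hk : x ≤ lam ^ k) : k ≤ m := by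
  by_contra! h
  exact (hx.1.trans_le (hk.trans (pow_le_pow_of_le_one h0.le h1.le h))).false

lemma iUnion_W_eq (h0 : 0 < lam) (h1 : lam < 1) (K : ℕ) :
    (⋃ k : ℕ, ⋃ _ : K < k, W lam k) = Ioc 0 (lam ^ K) := by
  ext x
  simp only [mem_iUnion, exists_prop]
  constructor
  · rintro ⟨k, hk, hx⟩
    exact ⟨(by positivity : (0 : ℝ) < lam ^ k).trans hx.1,
      hx.2.trans (pow_le_pow_of_le_one h0.le h1.le (by omega))⟩
  · intro hx
    obtain ⟨m, hm⟩ := exists_mem_cell h1 ⟨hx.1, hx.2.trans (pow_le_one₀ h0.le h1.le)⟩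
    exact ⟨m + 1, Nat.lt_succ_of_le (le_cell_of_le h0 h1 hm hx.2), hm⟩

lemma mem_Lambda_iff (h0 : 0 < lam) (h1 : lam < 1) {K : ℕ} {x : ℝ} :
    x ∈ Lambda lam K ↔ x ∈ Ioc (0 : ℝ) 1 ∧ ∀ i : ℕ, lam ^ K < (F lam)^[i] x := by
  rw [Lambda, iUnion_W_eq h0 h1, mem_ofPred_eq]
  refine and_congr_right fun hx => forall_congr' fun i => ?_
  have := ((F_mapsTo h0 h1).iterate i hx).1
  simp [this]

lemma F_mem_Lambda (h0 : 0 < lam) (h1 : lam < 1) {K : ℕ} {x : ℝ} (hx : x ∈ Lambda lam K) :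
    F lam x ∈ Lambda lam K := by
  rw [mem_Lambda_iff h0 h1] at hx ⊢
  exact ⟨F_mapsTo h0 h1 hx.1, fun i => hx.2 (i + 1)⟩

lemma Lambda_mono (h0 : 0 < lam) (h1 : lam < 1) : Monotone (Lambda lam) := by
  intro K L hKL x
  simp only [mem_Lambda_iff h0 h1]
  exact fun hx => ⟨hx.1, fun i => (pow_le_pow_of_le_one h0.le h1.le hKL).trans_lt (hx.2 i)⟩

end Cells

/-! ### The upper bound -/

/-- Size-`δ` Hausdorff premeasures scale under Lipschitz maps. Unlike the Hausdorff measure itself,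
they are finite on bounded sets, which is what an induction on the scale needs. -/
lemma LipschitzWith.mkMetric_pre_image_le {X Y : Type*} [EMetricSpace X] [EMetricSpace Y]
    {c : ℝ≥0} (hc : c ≠ 0) {f : X → Y} (hf : LipschitzWith c f) {s : ℝ} (hs : 0 ≤ s)
    (δ : ℝ≥0∞) (A : Set X) :
    OuterMeasure.mkMetric'.pre (fun t => Metric.ediam t ^ s) (c * δ) (f '' A) ≤
      (c : ℝ≥0∞) ^ s * OuterMeasure.mkMetric'.pre (fun t => Metric.ediam t ^ s) δ A := by
  have hc0 : (c : ℝ≥0∞) ^ s ≠ 0 := by simp [hc]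
  have hct : (c : ℝ≥0∞) ^ s ≠ ∞ := by simp [hc]
  have key : ((c : ℝ≥0∞) ^ s)⁻¹ • OuterMeasure.comap f
      (OuterMeasure.mkMetric'.pre (fun t => Metric.ediam t ^ s) (c * δ)) ≤
      OuterMeasure.mkMetric'.pre (fun t => Metric.ediam t ^ s) δ := by
    rw [OuterMeasure.mkMetric'.le_pre]
    intro t ht
    have h2 : Metric.ediam (f '' t) ≤ c * Metric.ediam t := hf.ediam_image_le t
    simp only [_root_.smul_apply, OuterMeasure.comap_apply, smul_eq_mul]
    rw [mul_comm, ← div_eq_mul_inv]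
    refine ENNReal.div_le_of_le_mul' ?_
    calc _ ≤ Metric.ediam (f '' t) ^ s :=
          OuterMeasure.mkMetric'.pre_le (h2.trans (by gcongr))
      _ ≤ (c * Metric.ediam t) ^ s := by gcongr
      _ = _ := ENNReal.mul_rpow_of_nonneg _ _ hs
  have := key A
  simp only [_root_.smul_apply, OuterMeasure.comap_apply, smul_eq_mul] at this
  rw [mul_comm, ← div_eq_mul_inv, ENNReal.div_le_iff hc0 hct] at this
  rwa [mul_comm _ ((c : ℝ≥0∞) ^ s)] at this

/-- A positive supersolution `τ` of the transfer inequality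
`τ (m + 1) + ratio m ^ s * τ (m - 1) ≤ τ m` bounds the `s`-dimensional Hausdorff measure. -/
lemma dimH_Lambda_le_of_supersolution {lam : ℝ} (h0 : 0 < lam) (h1 : lam < 1) {s : ℝ≥0}
    {τ : ℕ → ℝ} (hpos : ∀ m, 0 < τ m) (hanti : Antitone τ)
    (hτ : ∀ m, τ (m + 1) + ratio lam m ^ (s : ℝ) * τ (m - 1) ≤ τ m) (K : ℕ) :
    dimH (Lambda lam K) ≤ s := by
  have h1' : 0 < 1 - lam := sub_pos.2 h1
  have hU : ∀ m, K ≤ m → Lambda lam K ∩ Iic (lam ^ m) = ∅ := by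
    intro m hm
    refine eq_empty_of_forall_notMem fun x hx => ?_
    have h2 := ((mem_Lambda_iff h0 h1).1 hx.1).2 0
    exact (h2.trans_le (hx.2.trans (pow_le_pow_of_le_one h0.le h1.le hm))).false
  set H : ℝ≥0∞ → OuterMeasure ℝ :=
    OuterMeasure.mkMetric'.pre (fun t : Set ℝ => Metric.ediam t ^ (s : ℝ)) with hH
  -- The factor `1 / τ K` makes the bound at least `1` on all the nonempty pieces.
  set B : ℕ → ℝ≥0∞ := fun m => ENNReal.ofReal (τ m / τ K) with hB
  have key : ∀ n m, H (ENNReal.ofReal (1 - lam) ^ n) (Lambda lam K ∩ Iic (lam ^ m)) ≤ B m := by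
    intro n
    induction n with
    | zero =>
      intro m
      rcases le_or_gt K m with h | h
      · simp [hU m h]
      have hd : Metric.ediam (Lambda lam K ∩ Iic (lam ^ m)) ≤ 1 := by
        refine (Metric.ediam_mono (t := Icc (0 : ℝ) 1) ?_).trans (by simp [Real.ediam_Icc])
        intro x hx
        exact ⟨hx.1.1.1.le, hx.1.1.2⟩
      refine (OuterMeasure.mkMetric'.pre_le (by simpa using hd)).trans ?_
      calc _ ≤ (1 : ℝ≥0∞) ^ (s : ℝ) := by gcongr
        _ = 1 := by simp
        _ ≤ B m := by
          rw [hB, ENNReal.one_le_ofReal, one_le_div (hpos K)]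
          exact hanti h.le
    | succ n ih =>
      intro m
      -- Downward induction on `m`, starting from the empty piece `m = K`.
      induction hd : K - m generalizing m with
      | zero => simp [hU m (by omega)]
      | succ d ihd =>
        have ih' := ihd (m + 1) (by omega)
        have hr := ratio_pos h0 h1 m
        set φ : ℝ → ℝ := fun y => lam ^ (m + 1) + ratio lam m * y with hφ
        have hlip : LipschitzWith (ratio lam m).toNNReal φ := by
          refine LipschitzWith.of_dist_le_mul fun x y => ?_
          rw [Real.coe_toNNReal _ hr.le, hφ, Real.dist_eq, Real.dist_eq, ← abs_of_pos hr,
            ← abs_mul, abs_of_pos hr]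
          exact le_of_eq (by ring_nf)
        have hsub : Lambda lam K ∩ Iic (lam ^ m) ⊆
            (Lambda lam K ∩ Iic (lam ^ (m + 1))) ∪ φ '' (Lambda lam K ∩ Iic (lam ^ (m - 1))) := by
          intro x hx
          rcases le_or_gt x (lam ^ (m + 1)) with h2 | h2
          · exact Or.inl ⟨hx.1, h2⟩
          · have hc : x ∈ W lam (m + 1) := ⟨h2, hx.2⟩
            exact Or.inr ⟨F lam x, ⟨F_mem_Lambda h0 h1 hx.1, F_le_pow h0 h1 hc⟩,
              (eq_branch_F h0 h1 hc).symm⟩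
        calc _ ≤ _ := measure_mono hsub
          _ ≤ _ := measure_union_le _ _
          _ ≤ B (m + 1) + ENNReal.ofReal (ratio lam m) ^ (s : ℝ) * B (m - 1) := by
            gcongr
            refine le_trans ?_ (mul_le_mul_right (ih (m - 1)) _)
            refine le_trans ?_ (hlip.mkMetric_pre_image_le (by simpa using hr) s.2 _ _)
            refine OuterMeasure.mkMetric'.mono_pre _ ?_ _
            rw [pow_succ, mul_comm]
            gcongr
            exact ENNReal.ofReal_le_ofReal (ratio_le lam m)
          _ ≤ B m := by
            rw [hB, ENNReal.ofReal_rpow_of_nonneg hr.le s.coe_nonneg,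
              ← ENNReal.ofReal_mul (by positivity),
              ← ENNReal.ofReal_add (div_pos (hpos _) (hpos _)).le
                (mul_nonneg (by positivity) (div_pos (hpos _) (hpos _)).le)]
            refine ENNReal.ofReal_le_ofReal ?_
            rw [← mul_div_assoc, ← add_div]
            have := hpos K
            gcongr
            exact hτ m
  have hle : μH[(s : ℝ)] (Lambda lam K) ≤ B 0 := by
    rw [← MeasureTheory.Measure.coe_toOuterMeasure, hausdorffMeasure, mkMetric_toOuterMeasure,
      OuterMeasure.mkMetric, OuterMeasure.mkMetric', OuterMeasure.iSup_apply]
    refine iSup_le fun δ => ?_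
    rw [OuterMeasure.iSup_apply]
    refine iSup_le fun hδ => ?_
    have hq : ENNReal.ofReal (1 - lam) < 1 := by
      rw [ENNReal.ofReal_lt_one]; linarith
    obtain ⟨n, hn⟩ := ((ENNReal.tendsto_pow_atTop_nhds_zero_of_lt_one hq).eventually_lt_const
      hδ).exists
    refine (OuterMeasure.mkMetric'.mono_pre _ hn.le _).trans ?_
    have := key n 0
    rwa [pow_zero, inter_eq_left.2 (fun x hx => hx.1.2)] at this
  exact dimH_le_of_hausdorffMeasure_ne_top (ne_top_of_le_ne_top ENNReal.ofReal_ne_top hle)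

/-! ### A Hölder semiconjugacy built from a truncated solution -/

/-- A linear cohomological equation with contracting coefficients has a bounded solution, the sum
of the series obtained by iterating the equation. -/
lemma exists_bounded_solution {α : Type*} (f : α → α) {t k : α → ℝ} {q : ℝ} (hq : q < 1)
    (ht : ∀ x, |t x| ≤ 1) (hk : ∀ x, 0 ≤ k x) (hkq : ∀ x, k x ≤ q) :
    ∃ G : α → ℝ, (∃ M, ∀ x, |G x| ≤ M) ∧ ∀ x, G x = t x + k x * G (f x) := by
  set a : α → ℕ → ℝ := fun x n => (∏ l ∈ Finset.range n, k (f^[l] x)) * t (f^[n] x) with ha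
  have hab : ∀ x n, ‖a x n‖ ≤ q ^ n := by
    intro x n
    have h1 : 0 ≤ ∏ l ∈ Finset.range n, k (f^[l] x) := Finset.prod_nonneg fun _ _ => hk _
    have h2 : ∏ l ∈ Finset.range n, k (f^[l] x) ≤ q ^ n := by
      simpa using Finset.prod_le_prod (s := Finset.range n) (g := fun _ => q)
        (fun l _ => hk (f^[l] x)) (fun l _ => hkq _)
    rw [ha, norm_mul, Real.norm_of_nonneg h1, Real.norm_eq_abs]
    exact (mul_le_of_le_one_right h1 (ht _)).trans h2
  have hsum : ∀ x, Summable (a x) := by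
    intro x
    have hq0 : 0 ≤ q := (hk x).trans (hkq x)
    exact Summable.of_norm_bounded (summable_geometric_of_lt_one hq0 hq) (hab x)
  refine ⟨fun x => ∑' n, a x n, ⟨(1 - q)⁻¹, fun x => ?_⟩, fun x => ?_⟩
  · have hq0 : 0 ≤ q := (hk x).trans (hkq x)
    exact tsum_of_norm_bounded (hasSum_geometric_of_lt_one hq0 hq) (hab x)
  · show ∑' n, a x n = t x + k x * ∑' n, a (f x) n
    rw [(hsum x).tsum_eq_zero_add, ← (hsum (f x)).tsum_mul_left]
    congr 1
    · simp [ha]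
    · refine tsum_congr fun n => ?_
      simp only [ha, Finset.prod_range_succ', Function.iterate_succ_apply, Function.iterate_zero,
        id_eq]
      ring

/-- Data `τ`, `κ` as for a conservation law on the cells: mass `κ m * τ (m - 1)` is carried by the
cell `m`, and `τ m` is the mass of `(0, lam ^ m]`. All the mass is on the first `K` cells, and each
branch scales mass at most by the `s`-th power of its ratio. -/
structure MassData (lam s : ℝ) (K : ℕ) (τ κ : ℕ → ℝ) : Prop where
  nonneg : ∀ m, 0 ≤ τ m
  le_one : ∀ m, τ m ≤ 1
  zero : τ 0 = 1
  eq_zero : ∀ m, K ≤ m → τ m = 0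
  coeff_nonneg : ∀ m, 0 ≤ κ m
  coeff_le : ∀ m, κ m ≤ ratio lam m ^ s
  coeff_eq_zero : ∀ m, K ≤ m → κ m = 0
  balance : ∀ m, τ m = τ (m + 1) + κ m * τ (m - 1)

/-- The distribution function of the mass described by `τ` and `κ`: it satisfies the functional
equation coming from the branches of `F lam`. Here `G` need not be monotone a priori; boundedness
suffices for all the estimates. -/
structure IsDistribution (lam : ℝ) (τ κ : ℕ → ℝ) (M : ℝ) (G : ℝ → ℝ) : Prop where
  bound : ∀ x, |G x| ≤ M
  eq : ∀ m, ∀ x ∈ W lam (m + 1), G x = τ (m + 1) + κ m * G (F lam x)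

section Distribution

variable {lam s : ℝ} {K : ℕ} {τ κ : ℕ → ℝ} {M : ℝ} {G : ℝ → ℝ}

lemma ratio_rpow_le (h0 : 0 < lam) (h1 : lam < 1) (hs : 0 < s) (m : ℕ) :
    ratio lam m ^ s ≤ (1 - lam) ^ s :=
  Real.rpow_le_rpow (ratio_pos h0 h1 m).le (ratio_le lam m) hs.le

lemma one_sub_rpow_lt_one (h0 : 0 < lam) (h1 : lam < 1) (hs : 0 < s) : (1 - lam) ^ s < 1 :=
  Real.rpow_lt_one (sub_pos.2 h1).le (by linarith) hs

lemma MassData.exists_isDistribution (h : MassData lam s K τ κ) (h0 : 0 < lam) (h1 : lam < 1)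
    (hs : 0 < s) : ∃ M G, IsDistribution lam τ κ M G := by
  -- Outside `(0, 1]`, where there is no cell, `sInf ∅ = 0` assigns the cell `0`.
  set c : ℝ → ℕ := fun x => sInf {m | x ∈ W lam (m + 1)} with hc
  have hcell : ∀ m, ∀ x ∈ W lam (m + 1), c x = m := by
    intro m x hx
    have := W_index_unique h0 h1 (Nat.sInf_mem (s := {m | x ∈ W lam (m + 1)}) ⟨m, hx⟩) hx
    simpa using this
  obtain ⟨G, ⟨M, hM⟩, hG⟩ := exists_bounded_solution (F lam) (t := fun x => τ (c x + 1))
    (k := fun x => κ (c x)) (one_sub_rpow_lt_one h0 h1 hs)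
    (fun x => by rw [abs_of_nonneg (h.nonneg _)]; exact h.le_one _) (fun x => h.coeff_nonneg _)
    (fun x => (h.coeff_le _).trans (ratio_rpow_le h0 h1 hs _))
  refine ⟨M, G, hM, fun m x hx => ?_⟩
  rw [hG x, hcell m x hx]

namespace IsDistribution

lemma apply_pow (hG : IsDistribution lam τ κ M G) (h : MassData lam s K τ κ) (h0 : 0 < lam)
    (h1 : lam < 1) (hs : 0 < s) (m : ℕ) : G (lam ^ m) = τ m := by
  have hstep : ∀ m, G (lam ^ m) = τ (m + 1) + κ m * G (lam ^ (m - 1)) := fun m => by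
    rw [hG.eq m _ (pow_mem_cell h0 h1 m), F_pow h0 h1]
  induction m with
  | zero =>
    have e1 := hstep 0
    have e2 := h.balance 0
    simp only [zero_tsub, zero_add, h.zero, mul_one] at e1 e2
    have hκ : κ 0 < 1 := ((h.coeff_le 0).trans (ratio_rpow_le h0 h1 hs 0)).trans_lt
      (one_sub_rpow_lt_one h0 h1 hs)
    have : (1 - κ 0) * (G (lam ^ 0) - 1) = 0 := by linear_combination e1 - e2
    rcases mul_eq_zero.1 this with h' | h'
    · linarith
    · rw [sub_eq_zero.1 h', h.zero]
  | succ m ih => rw [hstep, h.balance (m + 1), Nat.add_sub_cancel, ih]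

lemma eq_zero (hG : IsDistribution lam τ κ M G) (h : MassData lam s K τ κ) (h0 : 0 < lam)
    (h1 : lam < 1) {x : ℝ} (hx : 0 < x) (hxK : x ≤ lam ^ K) : G x = 0 := by
  obtain ⟨m, hm⟩ := exists_mem_cell h1 ⟨hx, hxK.trans (pow_le_one₀ h0.le h1.le)⟩
  have hK := le_cell_of_le h0 h1 hm hxK
  rw [hG.eq m x hm, h.eq_zero _ (by omega), h.coeff_eq_zero _ hK]
  simp

lemma abs_sub_le_two_mul (hG : IsDistribution lam τ κ M G) (x y : ℝ) : |G y - G x| ≤ 2 * M := by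
  have := abs_sub (G y) (G x)
  linarith [hG.bound x, hG.bound y]

lemma nonneg_bound (hG : IsDistribution lam τ κ M G) : 0 ≤ M :=
  (abs_nonneg _).trans (hG.bound 0)

/-- On a common cell, a Hölder estimate up to an error for the images under `F lam` pulls back with
the same constant and a smaller error. -/
lemma pullback (hG : IsDistribution lam τ κ M G) (h : MassData lam s K τ κ) (h0 : 0 < lam)
    (h1 : lam < 1) (hs : 0 < s) {m : ℕ} {x y C ε : ℝ} (hC : 0 ≤ C) (hε : 0 ≤ ε)
    (hxy : x ≤ y) (hx : x ∈ W lam (m + 1)) (hy : y ∈ W lam (m + 1))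
    (hF : |G (F lam y) - G (F lam x)| ≤ C * (F lam y - F lam x) ^ s + ε) :
    |G y - G x| ≤ C * (y - x) ^ s + (1 - lam) ^ s * ε := by
  have hr := ratio_pos h0 h1 m
  have hsub := sub_eq_ratio_mul h0 h1 hx hy
  have hF0 : 0 ≤ F lam y - F lam x := by
    by_contra! hneg
    nlinarith
  have hκ := h.coeff_nonneg m
  have h3 := h.coeff_le m
  have h4 := ratio_rpow_le h0 h1 hs m
  have h5 : 0 ≤ C * (F lam y - F lam x) ^ s := by positivity
  rw [hG.eq m x hx, hG.eq m y hy, hsub, Real.mul_rpow hr.le hF0,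
    show τ (m + 1) + κ m * G (F lam y) - (τ (m + 1) + κ m * G (F lam x)) =
      κ m * (G (F lam y) - G (F lam x)) by ring, abs_mul, abs_of_nonneg hκ]
  calc κ m * |G (F lam y) - G (F lam x)| ≤ κ m * (C * (F lam y - F lam x) ^ s + ε) := by gcongr
    _ = κ m * (C * (F lam y - F lam x) ^ s) + κ m * ε := by ring
    _ ≤ ratio lam m ^ s * (C * (F lam y - F lam x) ^ s) + (1 - lam) ^ s * ε := by
      gcongr
      exact h3.trans h4
    _ = _ := by ring

/-- The trivial Hölder estimate for points at distance at least `δ`. -/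
lemma le_of_far (hG : IsDistribution lam τ κ M G) (hs : 0 < s) {x y δ : ℝ} (hδ : 0 < δ)
    (hxy : δ ≤ y - x) : |G y - G x| ≤ 2 * M / δ ^ s * (y - x) ^ s := by
  have hM := hG.nonneg_bound
  refine (hG.abs_sub_le_two_mul x y).trans ?_
  rw [div_mul_eq_mul_div, le_div_iff₀ (by positivity)]
  gcongr

/-- Hölder estimate, up to a geometrically small error, to the left of the cell endpoints. -/
lemma left_estimate (hG : IsDistribution lam τ κ M G) (h : MassData lam s K τ κ) (h0 : 0 < lam)
    (h1 : lam < 1) (hs : 0 < s) (n : ℕ) : ∀ m x, 0 < x → x ≤ lam ^ m →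
    |G (lam ^ m) - G x| ≤
      2 * M / (lam ^ K * (1 - lam)) ^ s * (lam ^ m - x) ^ s + ((1 - lam) ^ s) ^ n * (2 * M) := by
  have h1' : 0 < 1 - lam := sub_pos.2 h1
  have hM := hG.nonneg_bound
  induction n with
  | zero =>
    intro m x hx hxm
    have := hG.abs_sub_le_two_mul x (lam ^ m)
    have h3 : 0 ≤ lam ^ m - x := sub_nonneg.2 hxm
    have h2 : 0 ≤ 2 * M / (lam ^ K * (1 - lam)) ^ s * (lam ^ m - x) ^ s := by positivity
    simpa using by linarith
  | succ n ih =>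
    intro m x hx hxm
    have h3 : 0 ≤ lam ^ m - x := sub_nonneg.2 hxm
    rcases le_or_gt K m with hK | hK
    · have h4 : lam ^ m ≤ lam ^ K := pow_le_pow_of_le_one h0.le h1.le hK
      rw [hG.eq_zero h h0 h1 (by positivity) h4, hG.eq_zero h h0 h1 hx (hxm.trans h4), sub_zero,
        abs_zero]
      positivity
    rcases le_or_gt x (lam ^ (m + 1)) with hx2 | hx2
    · refine (hG.le_of_far hs (by positivity) ?_).trans (le_add_of_nonneg_right (by positivity))
      calc lam ^ K * (1 - lam) ≤ lam ^ m * (1 - lam) := by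
            have := pow_le_pow_of_le_one h0.le h1.le hK.le
            gcongr
        _ = lam ^ m - lam ^ (m + 1) := by ring
        _ ≤ _ := by linarith
    · have hxc : x ∈ W lam (m + 1) := ⟨hx2, hxm⟩
      have hF := ih (m - 1) (F lam x)
        (F_mapsTo h0 h1 (mem_Ioc_of_mem_cell h0 h1 hxc)).1 (F_le_pow h0 h1 hxc)
      rw [← F_pow h0 h1] at hF
      have := hG.pullback h h0 h1 hs (by positivity) (by positivity) hxm hxc
        (pow_mem_cell h0 h1 m) hF
      rwa [← mul_assoc, ← pow_succ'] at this

lemma abs_le_of_pos (hG : IsDistribution lam τ κ M G) (h : MassData lam s K τ κ) (h0 : 0 < lam)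
    (h1 : lam < 1) (hs : 0 < s) {z : ℝ} (hz : 0 < z) : |G z| ≤ M / (lam ^ K) ^ s * z ^ s := by
  have hM := hG.nonneg_bound
  rcases le_or_gt z (lam ^ K) with hzK | hzK
  · rw [hG.eq_zero h h0 h1 hz hzK, abs_zero]
    positivity
  · refine (hG.bound z).trans ?_
    rw [div_mul_eq_mul_div, le_div_iff₀ (by positivity)]
    gcongr

/-- Hölder estimate to the right of the cell endpoints. -/
lemma right_estimate (hG : IsDistribution lam τ κ M G) (h : MassData lam s K τ κ) (h0 : 0 < lam)
    (h1 : lam < 1) (hs : 0 < s) {m : ℕ} {y : ℝ} (hy : y ∈ W lam (m + 1)) :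
    |G y - G (lam ^ (m + 1))| ≤ M / (lam ^ K) ^ s * (y - lam ^ (m + 1)) ^ s := by
  have hr := ratio_pos h0 h1 m
  have hM := hG.nonneg_bound
  have hF := (F_mapsTo h0 h1 (mem_Ioc_of_mem_cell h0 h1 hy)).1
  have e : y - lam ^ (m + 1) = ratio lam m * F lam y := by linarith [eq_branch_F h0 h1 hy]
  rw [hG.apply_pow h h0 h1 hs, hG.eq m y hy, e, add_sub_cancel_left, abs_mul,
    abs_of_nonneg (h.coeff_nonneg m), Real.mul_rpow hr.le hF.le]
  calc κ m * |G (F lam y)| ≤ ratio lam m ^ s * (M / (lam ^ K) ^ s * F lam y ^ s) := by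
        have := h.coeff_le m
        have := hG.abs_le_of_pos h h0 h1 hs hF
        gcongr
    _ = _ := by ring

/-- Points in different cells: compare through a cell endpoint between them if the cells are
adjacent; otherwise the points are far apart. -/
lemma estimate_of_ne (hG : IsDistribution lam τ κ M G) (h : MassData lam s K τ κ) (h0 : 0 < lam)
    (h1 : lam < 1) (hs : 0 < s) (n : ℕ) {m : ℕ} {x y : ℝ} (hx : 0 < x) (hxm : x ≤ lam ^ (m + 1))
    (hy : y ∈ W lam (m + 1)) :
    |G y - G x| ≤ (2 * M / (lam ^ K * (1 - lam)) ^ s + M / (lam ^ K) ^ s) * (y - x) ^ s +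
      ((1 - lam) ^ s) ^ n * (2 * M) := by
  have h1' : 0 < 1 - lam := sub_pos.2 h1
  have hM := hG.nonneg_bound
  have hl := hG.left_estimate h h0 h1 hs n (m + 1) x hx hxm
  have hr := hG.right_estimate h h0 h1 hs hy
  have h2 : (lam ^ (m + 1) - x) ^ s ≤ (y - x) ^ s := by
    have := hy.1.le
    have : 0 ≤ lam ^ (m + 1) - x := sub_nonneg.2 hxm
    gcongr
  have h3 : (y - lam ^ (m + 1)) ^ s ≤ (y - x) ^ s := by
    have : 0 ≤ y - lam ^ (m + 1) := sub_nonneg.2 hy.1.le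
    gcongr
  calc |G y - G x| ≤ |G y - G (lam ^ (m + 1))| + |G (lam ^ (m + 1)) - G x| := abs_sub_le _ _ _
    _ ≤ M / (lam ^ K) ^ s * (y - x) ^ s +
        (2 * M / (lam ^ K * (1 - lam)) ^ s * (y - x) ^ s + ((1 - lam) ^ s) ^ n * (2 * M)) := by
      refine add_le_add (hr.trans (by gcongr)) (hl.trans (by gcongr))
    _ = _ := by ring

lemma estimate (hG : IsDistribution lam τ κ M G) (h : MassData lam s K τ κ) (h0 : 0 < lam)
    (h1 : lam < 1) (hs : 0 < s) (n : ℕ) : ∀ x y, 0 < x → x ≤ y → y ≤ 1 →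
    |G y - G x| ≤ (2 * M / (lam ^ K * (1 - lam)) ^ s + M / (lam ^ K) ^ s) * (y - x) ^ s +
      ((1 - lam) ^ s) ^ n * (2 * M) := by
  have h1' : 0 < 1 - lam := sub_pos.2 h1
  have hM := hG.nonneg_bound
  induction n with
  | zero =>
    intro x y hx hxy hy
    have := hG.abs_sub_le_two_mul x y
    have h3 : 0 ≤ y - x := sub_nonneg.2 hxy
    have h2 : 0 ≤ (2 * M / (lam ^ K * (1 - lam)) ^ s + M / (lam ^ K) ^ s) * (y - x) ^ s := by
      positivity
    simpa using by linarith
  | succ n ih =>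
    intro x y hx hxy hy
    obtain ⟨m, hm⟩ := exists_mem_cell h1 ⟨hx.trans_le hxy, hy⟩
    rcases le_or_gt x (lam ^ (m + 1)) with hxm | hxm
    · exact hG.estimate_of_ne h h0 h1 hs _ hx hxm hm
    · have hxc : x ∈ W lam (m + 1) := ⟨hxm, hxy.trans hm.2⟩
      have hFx := F_mapsTo h0 h1 (mem_Ioc_of_mem_cell h0 h1 hxc)
      have hFy := F_mapsTo h0 h1 (mem_Ioc_of_mem_cell h0 h1 hm)
      have hF : F lam x ≤ F lam y := by
        have := ratio_pos h0 h1 m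
        rw [F_of_mem_cell h0 h1 hxc, F_of_mem_cell h0 h1 hm]
        gcongr
      have := hG.pullback h h0 h1 hs (by positivity) (by positivity) hxy hxc hm
        (ih _ _ hFx.1 hF hFy.2)
      rwa [← mul_assoc, ← pow_succ'] at this

lemma exists_holderOnWith (hG : IsDistribution lam τ κ M G) (h : MassData lam s K τ κ)
    (h0 : 0 < lam) (h1 : lam < 1) (hs : 0 < s) :
    ∃ C : ℝ≥0, HolderOnWith C s.toNNReal G (Ioc 0 1) := by
  have h1' : 0 < 1 - lam := sub_pos.2 h1
  have hM := hG.nonneg_bound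
  set C : ℝ := 2 * M / (lam ^ K * (1 - lam)) ^ s + M / (lam ^ K) ^ s with hC
  have hC0 : 0 ≤ C := by positivity
  have hlim : ∀ x y, 0 < x → x ≤ y → y ≤ 1 → |G y - G x| ≤ C * (y - x) ^ s := by
    intro x y hx hxy hy
    have ht : Tendsto (fun n : ℕ => C * (y - x) ^ s + ((1 - lam) ^ s) ^ n * (2 * M)) atTop
        (𝓝 (C * (y - x) ^ s + 0 * (2 * M))) :=
      ((tendsto_pow_atTop_nhds_zero_of_lt_one (by positivity)
        (one_sub_rpow_lt_one h0 h1 hs)).mul_const _).const_add _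
    rw [zero_mul, add_zero] at ht
    exact ge_of_tendsto' ht fun n => hG.estimate h h0 h1 hs n x y hx hxy hy
  have hdist : ∀ x ∈ Ioc (0 : ℝ) 1, ∀ y ∈ Ioc (0 : ℝ) 1, dist (G x) (G y) ≤ C * dist x y ^ s := by
    intro x hx y hy
    rcases le_total x y with hxy | hxy
    · rw [dist_comm, dist_comm x, Real.dist_eq, Real.dist_eq, abs_of_nonneg (sub_nonneg.2 hxy)]
      exact hlim x y hx.1 hxy hy.2
    · rw [Real.dist_eq, Real.dist_eq, abs_of_nonneg (sub_nonneg.2 hxy)]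
      exact hlim y x hy.1 hxy hx.2
  refine ⟨C.toNNReal, fun x hx y hy => ?_⟩
  rw [edist_dist, edist_dist, Real.coe_toNNReal _ hs.le,
    ENNReal.ofReal_rpow_of_nonneg dist_nonneg hs.le,
    ← ENNReal.ofReal, ← ENNReal.ofReal_mul hC0]
  exact ENNReal.ofReal_le_ofReal (hdist x hx y hy)

/-- Every orbit that leaves the first `K` cells carries no mass after leaving them, so the value of
`G` is determined by the finite word of cells visited before. -/
lemma countable_image_compl (hG : IsDistribution lam τ κ M G) (h : MassData lam s K τ κ)
    (h0 : 0 < lam) (h1 : lam < 1) : (G '' (Ioc 0 1 \ Lambda lam K)).Countable := by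
  have key : ∀ n : ℕ, (G '' {x | x ∈ Ioc (0 : ℝ) 1 ∧ (F lam)^[n] x ≤ lam ^ K}).Countable := by
    intro n
    induction n with
    | zero =>
      refine (countable_singleton (0 : ℝ)).mono ?_
      rintro _ ⟨x, ⟨hx, hxK⟩, rfl⟩
      exact hG.eq_zero h h0 h1 hx.1 hxK
    | succ n ih =>
      refine (countable_iUnion fun m : ℕ => ih.image fun g => τ (m + 1) + κ m * g).mono ?_
      rintro _ ⟨x, ⟨hx, hxK⟩, rfl⟩
      obtain ⟨m, hm⟩ := exists_mem_cell h1 hx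
      exact mem_iUnion.2 ⟨m, G (F lam x), ⟨F lam x, ⟨F_mapsTo h0 h1 hx, hxK⟩, rfl⟩,
        (hG.eq m x hm).symm⟩
  refine (countable_iUnion key).mono ?_
  rintro _ ⟨x, ⟨hx, hxL⟩, rfl⟩
  rw [mem_Lambda_iff h0 h1] at hxL
  push Not at hxL
  obtain ⟨n, hn⟩ := hxL hx
  exact mem_iUnion.2 ⟨n, x, ⟨hx, hn⟩, rfl⟩

end IsDistribution

/-- Truncated solutions of the transfer equation give lower bounds for the dimension. -/
lemma MassData.le_dimH (h : MassData lam s K τ κ) (h0 : 0 < lam) (h1 : lam < 1) (hs : 0 < s) :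
    ENNReal.ofReal s ≤ dimH (Lambda lam K) := by
  obtain ⟨M, G, hG⟩ := h.exists_isDistribution h0 h1 hs
  obtain ⟨C, hC⟩ := hG.exists_holderOnWith h h0 h1 hs
  have hs' : 0 < s.toNNReal := Real.toNNReal_pos.2 hs
  have hIcc : Icc (lam ^ K) 1 ⊆ Ioc (0 : ℝ) 1 := fun x hx =>
    ⟨(by positivity : (0 : ℝ) < lam ^ K).trans_le hx.1, hx.2⟩
  have hsurj : Icc (0 : ℝ) 1 ⊆ G '' Ioc 0 1 := by
    have := intermediate_value_Icc (pow_le_one₀ h0.le h1.le) ((hC.continuousOn hs').mono hIcc)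
    have h2 : G 1 = 1 := by simpa [h.zero] using hG.apply_pow h h0 h1 hs 0
    rw [hG.apply_pow h h0 h1 hs, h.eq_zero K le_rfl, h2] at this
    exact this.trans (image_mono hIcc)
  have hL : Lambda lam K ⊆ Ioc 0 1 := fun x hx => hx.1
  have h3 : (1 : ℝ≥0∞) ≤ dimH (G '' Lambda lam K) := by
    calc (1 : ℝ≥0∞) = dimH (Icc (0 : ℝ) 1) := by
          rw [Real.dimH_of_nonempty_interior (by simp)]; simp
      _ ≤ dimH (G '' Lambda lam K ∪ G '' (Ioc 0 1 \ Lambda lam K)) := by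
          refine dimH_mono ?_
          rwa [← image_union, union_sdiff_cancel hL]
      _ = dimH (G '' Lambda lam K) := by
          rw [dimH_union, dimH_countable (hG.countable_image_compl h h0 h1)]
          simp
  have h4 := h3.trans ((hC.mono hL).dimH_image_le hs')
  rw [ENNReal.le_div_iff_mul_le (by simp [hs]) (by simp), one_mul] at h4
  exact h4

end Distribution

/-! ### The linear recurrence -/

/-- The solution of the transfer equation `τ m = τ (m + 1) + ratio m ^ s * τ (m - 1)` with
`τ 0 = 1`, where `a` and `b` stand for `ratio 0 ^ s` and `ratio m ^ s`, `m ≥ 1`. -/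
def recSol (a b : ℝ) : ℕ → ℝ
  | 0 => 1
  | 1 => 1 - a
  | m + 2 => recSol a b (m + 1) - b * recSol a b m

/-- The ratios `q` of consecutive terms satisfy `q' = 1 - b / q`. If this map has no fixed point
below the initial ratio `1 - a`, the ratios decrease until the solution loses its positivity. -/
lemma exists_recSol_nonpos {a b : ℝ} (hab : ∀ q ≤ 1 - a, q * (1 - q) < b) :
    ∃ m, recSol a b m ≤ 0 := by
  by_contra! hpos
  set q : ℕ → ℝ := fun m => recSol a b (m + 1) / recSol a b m with hq
  have hq0 : ∀ m, 0 < q m := fun m => div_pos (hpos _) (hpos _)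
  have hstep : ∀ m, q (m + 1) * q m = q m - b := by
    intro m
    have h1 := (hpos m).ne'
    have h2 := (hpos (m + 1)).ne'
    simp only [hq]
    rw [show recSol a b (m + 1 + 1) = recSol a b (m + 1) - b * recSol a b m from rfl]
    field_simp
  have hle : ∀ m, q m ≤ 1 - a := by
    intro m
    induction m with
    | zero => simp [hq, recSol]
    | succ m ih => nlinarith [hab _ ih, hstep m, hq0 m]
  have hanti : Antitone q := antitone_nat_of_succ_le fun m => by
    nlinarith [hab _ (hle m), hstep m, hq0 m]
  have hlim := tendsto_atTop_ciInf hanti ⟨0, by rintro _ ⟨m, rfl⟩; exact (hq0 m).le⟩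
  set L := ⨅ m, q m
  have hL : L ≤ 1 - a := le_of_tendsto' hlim hle
  have h1 : L * L = L - b := by
    refine tendsto_nhds_unique (((tendsto_add_atTop_iff_nat 1).2 hlim).mul hlim) ?_
    simp only [hstep]
    exact hlim.sub_const b
  linarith [hab L hL]

/-- Cutting the solution off at its first nonpositive term produces admissible mass data. -/
lemma exists_massData {lam s : ℝ} (h0 : 0 < lam) (h1 : lam < 1) (hs : 0 < s)
    (hab : ∀ q ≤ 1 - (1 - lam) ^ s, q * (1 - q) < (lam * (1 - lam)) ^ s) :
    ∃ K τ κ, MassData lam s K τ κ := by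
  classical
  have h1' : 0 < 1 - lam := sub_pos.2 h1
  set a := (1 - lam) ^ s with ha
  set b := (lam * (1 - lam)) ^ s with hb
  have ha0 : 0 < a := by positivity
  have ha1 : a < 1 := one_sub_rpow_lt_one h0 h1 hs
  have hb0 : 0 < b := by positivity
  set K := Nat.find (exists_recSol_nonpos hab) with hK
  have hK0 : recSol a b K ≤ 0 := Nat.find_spec (exists_recSol_nonpos hab)
  have hKpos : ∀ m < K, 0 < recSol a b m := fun m hm => not_le.1 (Nat.find_min _ hm)
  have hK2 : 2 ≤ K := by
    by_contra! h
    interval_cases K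
    · simp [recSol] at hK0; linarith
    · simp [recSol] at hK0; linarith
  set τ : ℕ → ℝ := fun m => if m < K then recSol a b m else 0 with hτ
  have hτlt : ∀ m < K, τ m = recSol a b m := fun m hm => if_pos hm
  have hτge : ∀ m, K ≤ m → τ m = 0 := fun m hm => if_neg hm.not_gt
  have hτ0 : ∀ m, 0 ≤ τ m := fun m => by
    rcases Nat.lt_or_ge m K with h | h
    · rw [hτlt m h]; exact (hKpos m h).le
    · rw [hτge m h]
  have hτzero : τ 0 = 1 := by rw [hτlt 0 (by omega)]; rfl
  have hτone : τ 1 = 1 - a := by rw [hτlt 1 (by omega)]; rfl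
  -- The defect of the truncated solution is nonnegative, and is absorbed into the last ratio.
  have hdefect : ∀ m, τ m - τ (m + 1) ≤ ratio lam m ^ s * τ (m - 1) := by
    intro m
    rcases m with _ | m
    · simp [ratio, hτzero, hτone, ← ha]
    have hr : ratio lam (m + 1) ^ s = b := by simp [ratio, hb]
    rw [hr, Nat.add_sub_cancel]
    have hrec : recSol a b (m + 2) = recSol a b (m + 1) - b * recSol a b m := rfl
    rcases lt_trichotomy (m + 2) K with h | h | h
    · rw [hτlt _ h, hτlt (m + 1) (by omega), hτlt m (by omega), hrec]
      linarith
    · rw [hτge (m + 1 + 1) h.ge, hτlt (m + 1) (by omega), hτlt m (by omega)]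
      rw [← h, hrec] at hK0
      linarith
    · rw [hτge (m + 1 + 1) (by omega), hτge (m + 1) (by omega), sub_zero]
      exact mul_nonneg hb0.le (hτ0 m)
  have hmono : ∀ m, τ (m + 1) ≤ τ m := by
    intro m
    rcases m with _ | m
    · rw [hτzero, hτone]; linarith
    rcases Nat.lt_or_ge (m + 2) K with h | h
    · rw [hτlt _ h, hτlt _ (by omega : m + 1 < K),
        show recSol a b (m + 1 + 1) = recSol a b (m + 1) - b * recSol a b m from rfl]
      linarith [mul_pos hb0 (hKpos m (by omega))]
    · rw [hτge _ h]; exact hτ0 _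
  -- When `τ (m - 1) = 0`, the quotient takes the junk value `0`, as it should.
  refine ⟨K, τ, fun m => (τ m - τ (m + 1)) / τ (m - 1), hτ0, ?_, hτzero, hτge, ?_, ?_, ?_, ?_⟩
  · intro m
    rw [← hτzero]
    exact antitone_nat_of_succ_le hmono (Nat.zero_le m)
  · exact fun m => div_nonneg (sub_nonneg.2 (hmono m)) (hτ0 _)
  · intro m
    have hr := ratio_pos h0 h1 m
    exact div_le_of_le_mul₀ (hτ0 _) (by positivity) (hdefect m)
  · intro m hm
    simp [hτge m hm, hτge (m + 1) (by omega)]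
  · intro m
    rcases (hτ0 (m - 1)).eq_or_lt with h | h
    · have h2 : τ m ≤ 0 := by
        rw [h]; exact antitone_nat_of_succ_le hmono (by omega)
      have h3 := (hτ0 m).antisymm h2
      have h4 := (hτ0 (m + 1)).antisymm ((hmono m).trans h2)
      simp [← h3, ← h4]
    · rw [div_mul_cancel₀ _ h.ne']; ring

/-! ### The limit -/

lemma tendsto_dimH_Lambda {lam D : ℝ} (h0 : 0 < lam) (h1 : lam < 1)
    (hle : ∀ K, dimH (Lambda lam K) ≤ ENNReal.ofReal D)
    (hab : ∀ s, 0 < s → s < D → ∀ q ≤ 1 - (1 - lam) ^ s, q * (1 - q) < (lam * (1 - lam)) ^ s) :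
    Tendsto (fun K : ℕ => dimH (Lambda lam K)) atTop (𝓝 (ENNReal.ofReal D)) := by
  refine tendsto_atTop_isLUB (fun K L h => dimH_mono (Lambda_mono h0 h1 h)) ⟨?_, ?_⟩
  · rintro _ ⟨K, rfl⟩
    exact hle K
  · intro u hu
    refine le_of_forall_lt fun c hc => ?_
    obtain ⟨t, hct, htD⟩ := ENNReal.lt_iff_exists_real_btwn.1 hc |>.imp fun _ h => h.2
    have ht : 0 < t := ENNReal.ofReal_pos.1 (bot_lt_of_lt hct)
    obtain ⟨K, τ, κ, h⟩ := exists_massData h0 h1 ht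
      (hab t ht ((ENNReal.ofReal_lt_ofReal_iff_of_nonneg ht.le).1 htD))
    exact hct.trans_le ((h.le_dimH h0 h1 ht).trans (hu ⟨K, rfl⟩))

theorem mainTheorem8 (lam : ℝ) (h0 : 0 < lam) (h1 : lam < 1) :
    (lam ≤ 1 / 2 →
      Tendsto (fun K : ℕ => dimH (Lambda lam K)) atTop (𝓝 1)) ∧
    (1 / 2 ≤ lam →
      Tendsto (fun K : ℕ => dimH (Lambda lam K)) atTop
        (𝓝 (ENNReal.ofReal (-Real.log 4 / Real.log (lam * (1 - lam)))))) := by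
  have h1' : 0 < 1 - lam := sub_pos.2 h1
  have hlt1 : lam * (1 - lam) < 1 := by nlinarith
  have hlog : Real.log (lam * (1 - lam)) < 0 := Real.log_neg (by positivity) hlt1
  constructor
  · intro hlam
    rw [← ENNReal.ofReal_one]
    refine tendsto_dimH_Lambda h0 h1 (fun K => ?_) fun s hs hs1 q hq => ?_
    · rw [ENNReal.ofReal_one, ← Real.dimH_univ]
      exact dimH_mono (subset_univ _)
    · -- With `a = (1 - lam) ^ s ≥ 1 / 2`, the maximum of `q * (1 - q)` over `q ≤ 1 - a` is
      -- `a * (1 - a)`, and `1 - a < lam ^ s` by strict subadditivity of `x ↦ x ^ s`.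
      have e1 : lam < lam ^ s := Real.self_lt_rpow_of_lt_one h0 h1 hs1
      have e2 : 1 - lam < (1 - lam) ^ s :=
        Real.self_lt_rpow_of_lt_one h1' (by linarith) hs1
      rw [Real.mul_rpow h0.le h1'.le]
      nlinarith
  · intro hlam
    set D := -Real.log 4 / Real.log (lam * (1 - lam)) with hD
    have h4 : 0 < Real.log 4 := Real.log_pos (by norm_num)
    have hD0 : 0 < D := div_pos_of_neg_of_neg (by linarith) hlog
    have hpow : (lam * (1 - lam)) ^ D = 1 / 4 := by
      rw [Real.rpow_def_of_pos (by positivity), hD, mul_div_cancel₀ _ hlog.ne, Real.exp_neg,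
        Real.exp_log (by norm_num), one_div]
    refine tendsto_dimH_Lambda h0 h1 (fun K => ?_) fun s hs hs1 q hq => ?_
    · -- At the critical exponent `1 / 2` is a double root of the characteristic polynomial
      -- `q ^ 2 - q + 1 / 4`; the powers of `1 / 2` are a supersolution since
      -- `(1 - lam) ^ (2 * D) ≤ (lam * (1 - lam)) ^ D = 1 / 4`.
      have ha : (1 - lam) ^ D ≤ 1 / 2 := by
        have e : (1 - lam) ^ D * (1 - lam) ^ D ≤ 1 / 4 := by
          rw [← hpow, ← Real.mul_rpow h1'.le h1'.le]
          refine Real.rpow_le_rpow (by positivity) ?_ hD0.le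
          nlinarith
        nlinarith [Real.rpow_nonneg h1'.le D]
      refine dimH_Lambda_le_of_supersolution h0 h1 (s := D.toNNReal)
        (τ := fun m => (1 / 2 : ℝ) ^ m) (fun m => by positivity)
        (pow_right_anti₀ (by norm_num) (by norm_num)) (fun m => ?_) K
      rw [Real.coe_toNNReal _ hD0.le]
      rcases m with _ | m
      · simp only [ratio, if_true, zero_add, pow_one, zero_tsub, pow_zero, mul_one]
        linarith
      · simp only [ratio, Nat.add_eq_zero_iff, one_ne_zero, and_false, if_false, hpow,
          Nat.add_sub_cancel]
        exact le_of_eq (by ring)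
    · have : 1 / 4 < (lam * (1 - lam)) ^ s := by
        rw [← hpow]
        exact Real.rpow_lt_rpow_of_exponent_gt (by positivity) hlt1 hs1
      nlinarith [sq_nonneg (q - 1 / 2)]
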